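/- Let $\lambda\in\mathbb C$ with $\operatorname{Re}\lambda>1$ and let $L=A\,\partial_x+B\,\partial_y$ be a complex vector field in the plane, where $A,B\in C^\infty(\mathbb R^2\setminus\{0\},\mathbb C)$ are homogeneous of degree $\lambda$, that is, $A(tx,ty)=t^\lambda A(x,y)$ and $B(tx,ty)=t^\lambda B(x,y)$ for all $(x,y)\neq 0$ and $t>0$. Assume that (C1) the set $\Sigma=\{(x,y)\in\mathbb R^2 : L\wedge\overline L=0\}=\{(x,y) : \operatorname{Im}(A\overline B)=0\}$ has empty interior, and (C2) $L\wedge(x\,\partial_x+y\,\partial_y)\neq 0$ everywhere in $\mathbb R^2\setminus\{0\}$. Put $a(\theta)=A(\cos\theta,\sin\theta)$, $b(\theta)=B(\cos\theta,\sin\theta)$, $p(\theta)=b(\theta)\cos\theta-a(\theta)\sin\theta$ (which never vanishes, by (C2)), $q(\theta)=i\,(a(\theta)\cos\theta+b(\theta)\sin\theta)$, and $$\mu=\frac1{2\pi}\int_0^{2\pi}\frac{q(\theta)}{p(\theta)}\,d\theta .$$ Theorem 3.6. $L$ has the Liouville property, meaning that every bounded continuous function $u:\mathbb R^2\setminus\{0\}\to\mathbb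 C$ that satisfies $Lu=0$ on $\mathbb R^2\setminus\{0\}$ in the sense of distributions is constant, if and only if $\operatorname{Re}\mu\neq 0$. -/

import Mathlib

open scoped ContDiff Distributions

noncomputable section

/-- A complex vector field `A ∂x + B ∂y` in the plane, given by its two coefficients. -/
structure PlaneVF where
  A : ℝ × ℝ → ℂ
  B : ℝ × ℝ → ℂ

/-- The punctured plane `ℝ² ∖ {0}`. -/
def puncturedPlane : TopologicalSpace.Opens (ℝ × ℝ) :=
  ⟨{0}ᶜ, isOpen_compl_singleton⟩

namespace PlaneVF

/-- The conjugate vector field, with coefficients the complex conjugates of `A` and `B`. -/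
def conj (L : PlaneVF) : PlaneVF where
  A z := starRingEnd ℂ (L.A z)
  B z := starRingEnd ℂ (L.B z)

/-- The radial vector field `x ∂x + y ∂y`. -/
def radial : PlaneVF where
  A z := (z.1 : ℂ)
  B z := (z.2 : ℂ)

/-- The coefficient of `X ∧ Y` with respect to `∂x ∧ ∂y`, at the point `z`. -/
def wedge (X Y : PlaneVF) (z : ℝ × ℝ) : ℂ :=
  X.A z * Y.B z - X.B z * Y.A z

/-- The set of points where `L` and its conjugate are linearly dependent. -/
def charSet (L : PlaneVF) : Set (ℝ × ℝ) :=
  {z | wedge L L.conj z = 0}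

/-- Both coefficients are smooth on the punctured plane. -/
def IsSmooth (L : PlaneVF) : Prop :=
  ContDiffOn ℝ ∞ L.A puncturedPlane ∧ ContDiffOn ℝ ∞ L.B puncturedPlane

/-- Both coefficients are positively homogeneous of complex degree `lam` on the punctured plane;
here `(t : ℂ) ^ lam = exp (lam * log t)`. -/
def IsHomogeneous (L : PlaneVF) (lam : ℂ) : Prop :=
  ∀ z ∈ puncturedPlane, ∀ t : ℝ, 0 < t →
    L.A (t • z) = (t : ℂ) ^ lam * L.A z ∧ L.B (t • z) = (t : ℂ) ^ lam * L.B z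

/-- The angular coefficient `p(θ) = b(θ) cos θ - a(θ) sin θ`, where `a` and `b` are the
restrictions of `A` and `B` to the unit circle. -/
def p (L : PlaneVF) (θ : ℝ) : ℂ :=
  L.B (Real.cos θ, Real.sin θ) * (Real.cos θ : ℂ) -
    L.A (Real.cos θ, Real.sin θ) * (Real.sin θ : ℂ)

/-- The coefficient `q(θ) = i (a(θ) cos θ + b(θ) sin θ)`. In polar coordinates,
`L = r ^ (lam - 1) (p(θ) ∂θ - i q(θ) r ∂r)`. -/
def q (L : PlaneVF) (θ : ℝ) : ℂ :=
  Complex.I * (L.A (Real.cos θ, Real.sin θ) * (Real.cos θ : ℂ) +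
    L.B (Real.cos θ, Real.sin θ) * (Real.sin θ : ℂ))

/-- The number `μ(L) = (1 / 2π) ∫₀^{2π} q(θ) / p(θ) dθ`. -/
def mu (L : PlaneVF) : ℂ :=
  1 / (2 * (Real.pi : ℂ)) * ∫ θ in (0 : ℝ)..(2 * Real.pi), L.q θ / L.p θ

/-- The formal transpose of `L` applied to `φ`, namely `-(∂x (A φ) + ∂y (B φ))`. -/
def transpose (L : PlaneVF) (φ : ℝ × ℝ → ℂ) (z : ℝ × ℝ) : ℂ :=
  -(fderiv ℝ (fun w => L.A w * φ w) z (1, 0) + fderiv ℝ (fun w => L.B w * φ w) z (0, 1))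

/-- `L u = 0` in the sense of distributions on the punctured plane, for `u` continuous there. -/
def IsWeakSolution (L : PlaneVF) (u : ℝ × ℝ → ℂ) : Prop :=
  ∀ φ : 𝓓(puncturedPlane, ℂ), ∫ z : ℝ × ℝ, u z * L.transpose φ z = 0

/-- Every bounded continuous complex-valued solution of `L u = 0` on the punctured plane is
constant there. The value of `u` at the origin plays no role. -/
def LiouvilleProperty (L : PlaneVF) : Prop :=
  ∀ u : ℝ × ℝ → ℂ, ContinuousOn u puncturedPlane →
    (∃ C : ℝ, ∀ z ∈ puncturedPlane, ‖u z‖ ≤ C) → L.IsWeakSolution u →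
      ∃ c : ℂ, ∀ z ∈ puncturedPlane, u z = c

end PlaneVF

end

open scoped ContDiff Distributions

noncomputable section

open MeasureTheory Set Filter Topology

/-! With `s = log r`, homogeneity makes `L` a nonvanishing multiple of `∂θ - c(θ) ∂s`, where `c = i
q / p`. Let `C` be a primitive of `c`. Formally, solutions are functions of `s + C(θ)`, and one turn
around the origin shifts this first integral by `∫ c = 2πiμ`, whose imaginary part is `2π Re μ`.

If `Re μ = 0` the shift is a real number `τ`. Some real `ξ ≠ 0` has `ξτ ∈ 2πℤ`, and then `exp (iξ (s
+ C(θ)))` is single-valued, bounded and nonconstant (`not_liouvilleProperty`).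

If `Re μ ≠ 0`, pull a bounded solution back to `v(s, θ)` and convolve in `s` with `exp (-b z²)`. The
result `g(z, θ)` is entire in `z` and bounded on horizontal strips. The equation says that `g(z -
C(θ), θ)` does not depend on `θ` (`IsWeakTransport.integral_deriv_mul_eq_zero`). Since the slices at
`±π` coincide, `g(·, -π)` has the non-real period `2πiμ`; it is therefore bounded, and constant by
Liouville's theorem (`gaussTransform_eq_of_periodic`). Letting `b → ∞` recovers `v`. Testing inside
`|θ| < π` is enough, because continuity supplies the two boundary slices. -/

/-! ### Logarithmic polar coordinates and change of variables -/

/-- Logarithmic polar coordinates `(s, θ) ↦ e ^ s (cos θ, sin θ)`. -/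
def expPolar (w : ℝ × ℝ) : ℝ × ℝ :=
  (Real.exp w.1 * Real.cos w.2, Real.exp w.1 * Real.sin w.2)

/-- The point of `ℂ` with the given real and imaginary parts. -/
def toComplex (z : ℝ × ℝ) : ℂ := Complex.equivRealProdCLM.symm z

/-- The principal branch of the inverse of `expPolar`. -/
def logPolar (z : ℝ × ℝ) : ℝ × ℝ := Complex.equivRealProdCLM (Complex.log (toComplex z))

theorem toComplex_re (z : ℝ × ℝ) : (toComplex z).re = z.1 := rfl
theorem toComplex_im (z : ℝ × ℝ) : (toComplex z).im = z.2 := rfl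

theorem toComplex_injective : Function.Injective toComplex :=
  Complex.equivRealProdCLM.symm.injective

theorem contDiff_toComplex {n : WithTop ℕ∞} : ContDiff ℝ n toComplex :=
  Complex.equivRealProdCLM.symm.contDiff

theorem toComplex_expPolar (w : ℝ × ℝ) : toComplex (expPolar w) = Complex.exp (toComplex w) := by
  apply Complex.ext
  · rw [Complex.exp_re]; rfl
  · rw [Complex.exp_im]; rfl

theorem toComplex_logPolar (z : ℝ × ℝ) : toComplex (logPolar z) = Complex.log (toComplex z) := by
  exact Complex.equivRealProdCLM.symm_apply_apply _

theorem toComplex_ne_zero {z : ℝ × ℝ} (hz : z ≠ 0) : toComplex z ≠ 0 := by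
  simpa [toComplex] using hz

theorem logPolar_snd (z : ℝ × ℝ) : (logPolar z).2 = Complex.arg (toComplex z) :=
  Complex.log_im _

theorem expPolar_ne_zero (w : ℝ × ℝ) : expPolar w ≠ 0 := by
  intro h
  have := toComplex_expPolar w
  rw [h] at this
  exact Complex.exp_ne_zero _ (this.symm.trans (by simp [toComplex]))

theorem expPolar_logPolar {z : ℝ × ℝ} (hz : z ≠ 0) : expPolar (logPolar z) = z := by
  apply toComplex_injective
  rw [toComplex_expPolar, toComplex_logPolar, Complex.exp_log (toComplex_ne_zero hz)]

theorem logPolar_expPolar {w : ℝ × ℝ} (hw : w.2 ∈ Ioc (-Real.pi) Real.pi) :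
    logPolar (expPolar w) = w := by
  apply toComplex_injective
  rw [toComplex_logPolar, toComplex_expPolar, Complex.log_exp hw.1 hw.2]

theorem contDiff_expPolar {n : WithTop ℕ∞} : ContDiff ℝ n expPolar := by
  unfold expPolar
  fun_prop

theorem continuous_expPolar : Continuous expPolar := contDiff_expPolar (n := 0).continuous

theorem contDiffAt_logPolar {z : ℝ × ℝ} {n : WithTop ℕ∞} (hz : toComplex z ∈ Complex.slitPlane) :
    ContDiffAt ℝ n logPolar z := by
  have h : ContDiffAt ℝ n Complex.log (toComplex z) :=
    (Complex.contDiffAt_log hz).restrict_scalars ℝ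
  exact Complex.equivRealProdCLM.contDiff.contDiffAt.comp z
    (h.comp z contDiff_toComplex.contDiffAt)

theorem hasFDerivAt_expPolar (w : ℝ × ℝ) :
    HasFDerivAt expPolar ((Matrix.toLin (.finTwoProd ℝ) (.finTwoProd ℝ)
      !![Real.exp w.1 * Real.cos w.2, -(Real.exp w.1 * Real.sin w.2);
         Real.exp w.1 * Real.sin w.2, Real.exp w.1 * Real.cos w.2]).toContinuousLinearMap) w := by
  rw [Matrix.toLin_finTwoProd_toContinuousLinearMap]
  have h1 : HasFDerivAt (fun w : ℝ × ℝ => Real.exp w.1)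
      (Real.exp w.1 • ContinuousLinearMap.fst ℝ ℝ ℝ) w :=
    (Real.hasDerivAt_exp w.1).comp_hasFDerivAt w hasFDerivAt_fst
  have h2 : HasFDerivAt (fun w : ℝ × ℝ => Real.cos w.2)
      ((-Real.sin w.2) • ContinuousLinearMap.snd ℝ ℝ ℝ) w :=
    (Real.hasDerivAt_cos w.2).comp_hasFDerivAt w hasFDerivAt_snd
  have h3 : HasFDerivAt (fun w : ℝ × ℝ => Real.sin w.2)
      (Real.cos w.2 • ContinuousLinearMap.snd ℝ ℝ ℝ) w :=
    (Real.hasDerivAt_sin w.2).comp_hasFDerivAt w hasFDerivAt_snd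
  refine ((h1.mul h2).prodMk (h1.mul h3)).congr_fderiv ?_
  ext <;> simp <;> ring

theorem fderiv_expPolar_apply (w v : ℝ × ℝ) :
    fderiv ℝ expPolar w v = ((expPolar w).1 * v.1 - (expPolar w).2 * v.2,
      (expPolar w).2 * v.1 + (expPolar w).1 * v.2) := by
  rw [(hasFDerivAt_expPolar w).fderiv, Matrix.toLin_finTwoProd_toContinuousLinearMap]
  simp [expPolar]
  ring

theorem det_fderiv_expPolar (w : ℝ × ℝ) :
    (fderiv ℝ expPolar w).det = Real.exp w.1 ^ 2 := by
  rw [(hasFDerivAt_expPolar w).fderiv]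
  simp only [LinearMap.det_toContinuousLinearMap, LinearMap.det_toLin, Matrix.det_fin_two_of]
  linear_combination Real.exp w.1 ^ 2 * Real.sin_sq_add_cos_sq w.2

theorem toComplex_mem_slitPlane_expPolar {w : ℝ × ℝ} (hw : w.2 ∈ Ioo (-Real.pi) Real.pi) :
    toComplex (expPolar w) ∈ Complex.slitPlane := by
  rw [Complex.mem_slitPlane_iff_arg]
  refine ⟨?_, toComplex_ne_zero (expPolar_ne_zero w)⟩
  rw [← logPolar_snd, logPolar_expPolar ⟨hw.1, hw.2.le⟩]
  exact hw.2.ne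

theorem logPolar_snd_mem {z : ℝ × ℝ} (hz : toComplex z ∈ Complex.slitPlane) :
    (logPolar z).2 ∈ Ioo (-Real.pi) Real.pi := by
  rw [logPolar_snd]
  exact ⟨Complex.neg_pi_lt_arg _, Complex.arg_lt_pi_iff.2 (by
    rcases hz with h | h
    · exact Or.inl h.le
    · exact Or.inr h)⟩

theorem image_expPolar_strip :
    expPolar '' (univ ×ˢ Ioo (-Real.pi) Real.pi) = polarCoord.source := by
  ext z
  constructor
  · rintro ⟨w, hw, rfl⟩
    exact toComplex_mem_slitPlane_expPolar hw.2
  · intro hz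
    have hz' : toComplex z ∈ Complex.slitPlane := hz
    refine ⟨logPolar z, ⟨mem_univ _, logPolar_snd_mem hz'⟩, expPolar_logPolar ?_⟩
    rintro rfl
    simp [toComplex] at hz'

/-- On the open strip `expPolar` is injective with Jacobian `e^(2s)`, and its image misses only a
null ray. -/
theorem integral_expPolar (f : ℝ × ℝ → ℂ) :
    ∫ z, f z = ∫ w in univ ×ˢ Ioo (-Real.pi) Real.pi,
      ((Real.exp w.1 ^ 2 : ℝ) : ℂ) * f (expPolar w) := by
  rw [← setIntegral_univ, ← setIntegral_congr_set polarCoord_source_ae_eq_univ,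
    ← image_expPolar_strip, integral_image_eq_integral_abs_det_fderiv_smul volume
      (MeasurableSet.univ.prod measurableSet_Ioo)
      (fun w _ => (hasFDerivAt_expPolar w).differentiableAt.hasFDerivAt.hasFDerivWithinAt)]
  · simp [det_fderiv_expPolar]
  · intro a ha b hb h
    rw [← logPolar_expPolar (Ioo_subset_Ioc_self ha.2), h,
      logPolar_expPolar (Ioo_subset_Ioc_self hb.2)]

/-! ### The vector field in polar form -/

namespace PlaneVF

/-- In logarithmic polar coordinates, `L` is a multiple of `∂θ - c(θ) ∂s`. -/
def slope (L : PlaneVF) (θ : ℝ) : ℂ := Complex.I * L.q θ / L.p θ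

/-- The pairing of `L` with the angular covector. -/
def angular (L : PlaneVF) (z : ℝ × ℝ) : ℂ := L.B z * z.1 - L.A z * z.2

theorem angular_ne_zero {L : PlaneVF} (hC2 : ∀ z ∈ puncturedPlane, wedge L radial z ≠ 0)
    {z : ℝ × ℝ} (hz : z ≠ 0) : L.angular z ≠ 0 := by
  have := hC2 z hz
  intro h
  apply this
  simp only [wedge, radial]
  unfold angular at h
  linear_combination -h

theorem cos_sin_ne_zero (θ : ℝ) : (Real.cos θ, Real.sin θ) ≠ (0 : ℝ × ℝ) := by
  intro h
  have := Real.sin_sq_add_cos_sq θ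
  simp only [Prod.mk_eq_zero] at h
  simp [h.1, h.2] at this

theorem p_ne_zero {L : PlaneVF} (hC2 : ∀ z ∈ puncturedPlane, wedge L radial z ≠ 0) (θ : ℝ) :
    L.p θ ≠ 0 := angular_ne_zero hC2 (cos_sin_ne_zero θ)

theorem contDiff_circle {f : ℝ × ℝ → ℂ} (hf : ContDiffOn ℝ ∞ f puncturedPlane) :
    ContDiff ℝ ∞ (fun θ : ℝ => f (Real.cos θ, Real.sin θ)) := by
  have h : ContDiff ℝ ∞ (fun θ : ℝ => (Real.cos θ, Real.sin θ)) := by fun_prop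
  rw [← contDiffOn_univ]
  exact hf.comp h.contDiffOn fun θ _ => cos_sin_ne_zero θ

theorem contDiff_slope {L : PlaneVF} (hL : L.IsSmooth)
    (hC2 : ∀ z ∈ puncturedPlane, wedge L radial z ≠ 0) : ContDiff ℝ ∞ L.slope := by
  have hA := contDiff_circle hL.1
  have hB := contDiff_circle hL.2
  have hc : ContDiff ℝ ∞ (fun θ : ℝ => (Real.cos θ : ℂ)) :=
    Complex.ofRealCLM.contDiff.comp Real.contDiff_cos
  have hs : ContDiff ℝ ∞ (fun θ : ℝ => (Real.sin θ : ℂ)) :=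
    Complex.ofRealCLM.contDiff.comp Real.contDiff_sin
  have hp : ContDiff ℝ ∞ L.p := (hB.mul hc).sub (hA.mul hs)
  have hq : ContDiff ℝ ∞ L.q := contDiff_const.mul ((hA.mul hc).add (hB.mul hs))
  have h : L.slope = fun θ => Complex.I * L.q θ * (L.p θ)⁻¹ := by
    funext θ
    exact div_eq_mul_inv _ _
  rw [h]
  exact (contDiff_const.mul hq).mul (hp.inv (p_ne_zero hC2))

theorem slope_periodic (L : PlaneVF) : Function.Periodic L.slope (2 * Real.pi) := by
  intro θ
  simp [slope, p, q]

/-- The radial coefficient of `L` is `-slope` times its angular coefficient. -/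
theorem radial_coeff_expPolar {L : PlaneVF} {lam : ℂ} (hhom : L.IsHomogeneous lam)
    (hC2 : ∀ z ∈ puncturedPlane, wedge L radial z ≠ 0) (w : ℝ × ℝ) :
    L.A (expPolar w) * (expPolar w).1 + L.B (expPolar w) * (expPolar w).2 =
      -L.slope w.2 * L.angular (expPolar w) := by
  have h := hhom _ (cos_sin_ne_zero w.2) (Real.exp w.1) (Real.exp_pos _)
  have e : Real.exp w.1 • (Real.cos w.2, Real.sin w.2) = expPolar w := rfl
  rw [e] at h
  have hp := p_ne_zero hC2 w.2
  have hs : L.slope w.2 * L.p w.2 = Complex.I * L.q w.2 := div_mul_cancel₀ _ hp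
  have hI := Complex.I_mul_I
  unfold angular
  rw [h.1, h.2]
  simp only [q, p] at hs
  simp only [expPolar, Complex.ofReal_mul]
  linear_combination ((Real.exp w.1 : ℂ) ^ lam * Real.exp w.1) * hs +
    ((Real.exp w.1 : ℂ) ^ lam * Real.exp w.1) * (L.A (Real.cos w.2, Real.sin w.2) * Real.cos w.2 +
    L.B (Real.cos w.2, Real.sin w.2) * Real.sin w.2) * hI

/-- The factor `i` turns `Re μ` into the imaginary part of the increment of the first integral over
one turn. -/
theorem integral_slope (L : PlaneVF) :
    ∫ θ in (0 : ℝ)..(2 * Real.pi), L.slope θ = Complex.I * (2 * Real.pi * L.mu) := by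
  have h : (Real.pi : ℂ) ≠ 0 := by exact_mod_cast Real.pi_ne_zero
  unfold mu slope
  simp_rw [mul_div_assoc]
  rw [intervalIntegral.integral_const_mul]
  field_simp

end PlaneVF

theorem hasDerivAt_comp_expPolar_fst {f : ℝ × ℝ → ℂ} {s θ : ℝ}
    (hf : DifferentiableAt ℝ f (expPolar (s, θ))) :
    HasDerivAt (fun t => f (expPolar (t, θ)))
      ((expPolar (s, θ)).1 * fderiv ℝ f (expPolar (s, θ)) (1, 0) +
        (expPolar (s, θ)).2 * fderiv ℝ f (expPolar (s, θ)) (0, 1)) s := by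
  have h1 : HasDerivAt (fun t : ℝ => (t, θ)) ((1 : ℝ), (0 : ℝ)) s :=
    (hasDerivAt_id s).prodMk (hasDerivAt_const s θ)
  have h2 := ((hasFDerivAt_expPolar (s, θ)).differentiableAt.hasFDerivAt).comp_hasDerivAt s h1
  have h3 := hf.hasFDerivAt.comp_hasDerivAt s h2
  refine h3.congr_deriv ?_
  rw [fderiv_expPolar_apply]
  have e : ((expPolar (s, θ)).1 * 1 - (expPolar (s, θ)).2 * 0,
      (expPolar (s, θ)).2 * 1 + (expPolar (s, θ)).1 * 0) =
      (expPolar (s, θ)).1 • ((1 : ℝ), (0 : ℝ)) + (expPolar (s, θ)).2 • ((0 : ℝ), (1 : ℝ)) := by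
    simp
  simp only [e, map_add, map_smul, Complex.real_smul]

theorem hasDerivAt_comp_expPolar_snd {f : ℝ × ℝ → ℂ} {s θ : ℝ}
    (hf : DifferentiableAt ℝ f (expPolar (s, θ))) :
    HasDerivAt (fun t => f (expPolar (s, t)))
      (-(expPolar (s, θ)).2 * fderiv ℝ f (expPolar (s, θ)) (1, 0) +
        (expPolar (s, θ)).1 * fderiv ℝ f (expPolar (s, θ)) (0, 1)) θ := by
  have h1 : HasDerivAt (fun t : ℝ => (s, t)) ((0 : ℝ), (1 : ℝ)) θ :=
    (hasDerivAt_const θ s).prodMk (hasDerivAt_id θ)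
  have h2 := ((hasFDerivAt_expPolar (s, θ)).differentiableAt.hasFDerivAt).comp_hasDerivAt θ h1
  have h3 := hf.hasFDerivAt.comp_hasDerivAt θ h2
  refine h3.congr_deriv ?_
  rw [fderiv_expPolar_apply]
  have e : ((expPolar (s, θ)).1 * 0 - (expPolar (s, θ)).2 * 1,
      (expPolar (s, θ)).2 * 0 + (expPolar (s, θ)).1 * 1) =
      (-(expPolar (s, θ)).2) • ((1 : ℝ), (0 : ℝ)) + (expPolar (s, θ)).1 • ((0 : ℝ), (1 : ℝ)) := by
    simp
  simp only [e, map_add, map_smul, Complex.real_smul, Complex.ofReal_neg]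

/-! ### Transfer of the weak equation to the strip -/

namespace PlaneVF

/-- The test function on the plane that corresponds to a function `F` of `(s, θ)`. -/
def testOf (L : PlaneVF) (F : ℝ × ℝ → ℂ) (z : ℝ × ℝ) : ℂ := F (logPolar z) / L.angular z

variable {L : PlaneVF} {lam : ℂ} {F : ℝ × ℝ → ℂ}

theorem testOf_expPolar {w : ℝ × ℝ} (hw : w.2 ∈ Ioc (-Real.pi) Real.pi) :
    L.testOf F (expPolar w) = F w / L.angular (expPolar w) := by
  rw [testOf, logPolar_expPolar hw]

theorem tsupport_testOf_subset (hF : HasCompactSupport F) :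
    tsupport (L.testOf F) ⊆ expPolar '' tsupport F := by
  refine closure_minimal ?_ (hF.image continuous_expPolar).isClosed
  intro z hz
  -- At the origin `angular` is zero, and division by zero returns `0`.
  have h0 : z ≠ 0 := by
    rintro rfl
    simp [testOf, angular] at hz
  refine ⟨logPolar z, subset_tsupport _ fun h => hz ?_, expPolar_logPolar h0⟩
  simp [testOf, h]

theorem hasCompactSupport_testOf (hF : HasCompactSupport F) :
    HasCompactSupport (L.testOf F) :=
  HasCompactSupport.of_support_subset_isCompact (hF.image continuous_expPolar)
    ((subset_tsupport _).trans (tsupport_testOf_subset hF))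

theorem contDiffAt_coeff {f : ℝ × ℝ → ℂ} (hf : ContDiffOn ℝ ∞ f puncturedPlane) {z : ℝ × ℝ}
    (hz : z ≠ 0) : ContDiffAt ℝ ∞ f z :=
  hf.contDiffAt (puncturedPlane.isOpen.mem_nhds hz)

theorem contDiffAt_testOf (hL : L.IsSmooth)
    (hC2 : ∀ z ∈ puncturedPlane, wedge L radial z ≠ 0) (hF : ContDiff ℝ ∞ F) {w : ℝ × ℝ}
    (hw : w.2 ∈ Ioo (-Real.pi) Real.pi) : ContDiffAt ℝ ∞ (L.testOf F) (expPolar w) := by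
  have h0 := expPolar_ne_zero w
  have hx : ContDiffAt ℝ ∞ (fun z : ℝ × ℝ => (z.1 : ℂ)) (expPolar w) :=
    (Complex.ofRealCLM.contDiff.comp contDiff_fst).contDiffAt
  have hy : ContDiffAt ℝ ∞ (fun z : ℝ × ℝ => (z.2 : ℂ)) (expPolar w) :=
    (Complex.ofRealCLM.contDiff.comp contDiff_snd).contDiffAt
  have hD : ContDiffAt ℝ ∞ L.angular (expPolar w) :=
    ((contDiffAt_coeff hL.2 h0).mul hx).sub ((contDiffAt_coeff hL.1 h0).mul hy)
  have h : L.testOf F = fun z => F (logPolar z) * (L.angular z)⁻¹ := by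
    funext z
    exact div_eq_mul_inv _ _
  rw [h]
  exact (hF.contDiffAt.comp _ (contDiffAt_logPolar (toComplex_mem_slitPlane_expPolar hw))).mul
    (hD.inv (angular_ne_zero hC2 h0))

/-- A smooth function compactly supported in the open strip gives a test function. -/
def testFunction (hL : L.IsSmooth) (hC2 : ∀ z ∈ puncturedPlane, wedge L radial z ≠ 0)
    (hF : ContDiff ℝ ∞ F) (hc : HasCompactSupport F)
    (hs : tsupport F ⊆ univ ×ˢ Ioo (-Real.pi) Real.pi) : 𝓓(puncturedPlane, ℂ) where
  toFun := L.testOf F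
  contDiff' := by
    refine contDiff_iff_contDiffAt.2 fun z => ?_
    by_cases hz : z ∈ tsupport (L.testOf F)
    · obtain ⟨w, hw, rfl⟩ := tsupport_testOf_subset hc hz
      exact contDiffAt_testOf hL hC2 hF (hs hw).2
    · exact contDiffAt_const.congr_of_eventuallyEq (notMem_tsupport_iff_eventuallyEq.1 hz)
  hasCompactSupport' := hasCompactSupport_testOf hc
  tsupport_subset' := by
    intro z hz
    obtain ⟨w, -, rfl⟩ := tsupport_testOf_subset hc hz
    exact expPolar_ne_zero w

/-- Dividing by `angular` removes `lam`: the field becomes `e^(-2s) (∂θ - c ∂s)`, whose `∂x` and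
`∂y` components are computed here and in `B_div_angular`. -/
theorem A_div_angular (hhom : L.IsHomogeneous lam)
    (hC2 : ∀ z ∈ puncturedPlane, wedge L radial z ≠ 0) (w : ℝ × ℝ) :
    L.A (expPolar w) / L.angular (expPolar w) =
      Real.exp (-w.1) * (-L.slope w.2 * Real.cos w.2 - Real.sin w.2) := by
  have h := radial_coeff_expPolar hhom hC2 w
  have hD := angular_ne_zero hC2 (expPolar_ne_zero w)
  have hD' : L.angular (expPolar w) = L.B (expPolar w) * (expPolar w).1 -
    L.A (expPolar w) * (expPolar w).2 := rfl
  have he : (Real.exp w.1 : ℂ) ≠ 0 := by exact_mod_cast (Real.exp_pos _).ne'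
  have hcs : (Real.sin w.2 : ℂ) ^ 2 + (Real.cos w.2 : ℂ) ^ 2 = 1 := by
    exact_mod_cast Real.sin_sq_add_cos_sq w.2
  generalize L.angular (expPolar w) = D at *
  simp only [expPolar, Complex.ofReal_mul] at h hD'
  simp only [expPolar]
  rw [Real.exp_neg, Complex.ofReal_inv]
  field_simp
  linear_combination Real.cos w.2 * h + Real.sin w.2 * hD' -
    Real.exp w.1 * L.A (Real.exp w.1 * Real.cos w.2, Real.exp w.1 * Real.sin w.2) * hcs

theorem B_div_angular (hhom : L.IsHomogeneous lam)
    (hC2 : ∀ z ∈ puncturedPlane, wedge L radial z ≠ 0) (w : ℝ × ℝ) :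
    L.B (expPolar w) / L.angular (expPolar w) =
      Real.exp (-w.1) * (-L.slope w.2 * Real.sin w.2 + Real.cos w.2) := by
  have h := radial_coeff_expPolar hhom hC2 w
  have hD := angular_ne_zero hC2 (expPolar_ne_zero w)
  have hD' : L.angular (expPolar w) = L.B (expPolar w) * (expPolar w).1 -
    L.A (expPolar w) * (expPolar w).2 := rfl
  have he : (Real.exp w.1 : ℂ) ≠ 0 := by exact_mod_cast (Real.exp_pos _).ne'
  have hcs : (Real.sin w.2 : ℂ) ^ 2 + (Real.cos w.2 : ℂ) ^ 2 = 1 := by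
    exact_mod_cast Real.sin_sq_add_cos_sq w.2
  generalize L.angular (expPolar w) = D at *
  simp only [expPolar, Complex.ofReal_mul] at h hD'
  simp only [expPolar]
  rw [Real.exp_neg, Complex.ofReal_inv]
  field_simp
  linear_combination Real.sin w.2 * h - Real.cos w.2 * hD' -
    Real.exp w.1 * L.B (Real.exp w.1 * Real.cos w.2, Real.exp w.1 * Real.sin w.2) * hcs

/-- Division by `angular` in `testOf` is chosen so that, against the Jacobian `e^(2s)`, the
transpose becomes that of `∂θ - c ∂s`, without zeroth-order term. -/
theorem transpose_testOf (hL : L.IsSmooth) (hhom : L.IsHomogeneous lam)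
    (hC2 : ∀ z ∈ puncturedPlane, wedge L radial z ≠ 0) (hF : ContDiff ℝ ∞ F) {s θ : ℝ}
    (hθ : θ ∈ Ioo (-Real.pi) Real.pi) :
    ((Real.exp s ^ 2 : ℝ) : ℂ) * L.transpose (L.testOf F) (expPolar (s, θ)) =
      -(fderiv ℝ F (s, θ) (0, 1) - L.slope θ * fderiv ℝ F (s, θ) (1, 0)) := by
  have hφ := (contDiffAt_testOf (w := (s, θ)) hL hC2 hF hθ).differentiableAt (by simp)
  have h0 := expPolar_ne_zero (s, θ)
  have hA := ((contDiffAt_coeff hL.1 h0).differentiableAt (by simp)).fun_mul hφ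
  have hB := ((contDiffAt_coeff hL.2 h0).differentiableAt (by simp)).fun_mul hφ
  have e1 : ∀ w : ℝ × ℝ, w.2 ∈ Ioo (-Real.pi) Real.pi →
      L.A (expPolar w) * L.testOf F (expPolar w) =
      F w * (Real.exp (-w.1) * (-L.slope w.2 * Real.cos w.2 - Real.sin w.2)) := by
    intro w hw
    rw [testOf_expPolar (Ioo_subset_Ioc_self hw), ← A_div_angular hhom hC2 w]
    ring
  have e2 : ∀ w : ℝ × ℝ, w.2 ∈ Ioo (-Real.pi) Real.pi →
      L.B (expPolar w) * L.testOf F (expPolar w) =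
      F w * (Real.exp (-w.1) * (-L.slope w.2 * Real.sin w.2 + Real.cos w.2)) := by
    intro w hw
    rw [testOf_expPolar (Ioo_subset_Ioc_self hw), ← B_div_angular hhom hC2 w]
    ring
  have hFd : DifferentiableAt ℝ F (s, θ) := hF.contDiffAt.differentiableAt (by simp)
  have hFs : HasDerivAt (fun t => F (t, θ)) (fderiv ℝ F (s, θ) (1, 0)) s :=
    hFd.hasFDerivAt.comp_hasDerivAt s ((hasDerivAt_id s).prodMk (hasDerivAt_const s θ))
  have hFt : HasDerivAt (fun t => F (s, t)) (fderiv ℝ F (s, θ) (0, 1)) θ :=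
    hFd.hasFDerivAt.comp_hasDerivAt θ ((hasDerivAt_const θ s).prodMk (hasDerivAt_id θ))
  have hexp : HasDerivAt (fun t : ℝ => (Real.exp (-t) : ℂ)) (-Real.exp (-s) : ℂ) s := by
    simpa using ((Real.hasDerivAt_exp (-s)).comp s (hasDerivAt_neg s)).ofReal_comp
  have hc := ((contDiff_slope hL hC2).contDiffAt.differentiableAt (x := θ) (by simp)).hasDerivAt
  have hcos := (Real.hasDerivAt_cos θ).ofReal_comp
  have hsin := (Real.hasDerivAt_sin θ).ofReal_comp
  -- Each polar derivative of `A φ` and `B φ` is computed twice, by the chain rule and from the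
  -- explicit formula; uniqueness gives four linear equations.
  have a1 := (hasDerivAt_comp_expPolar_fst hA).unique
    ((hFs.fun_mul (hexp.mul_const (-L.slope θ * Real.cos θ - Real.sin θ))).congr_of_eventuallyEq
      (Eventually.of_forall fun t => e1 (t, θ) hθ))
  have b1 := (hasDerivAt_comp_expPolar_fst hB).unique
    ((hFs.fun_mul (hexp.mul_const (-L.slope θ * Real.sin θ + Real.cos θ))).congr_of_eventuallyEq
      (Eventually.of_forall fun t => e2 (t, θ) hθ))
  have a2 := (hasDerivAt_comp_expPolar_snd hA).unique
    ((hFt.fun_mul (((hc.fun_neg.fun_mul hcos).fun_sub hsin).const_mul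
      (Real.exp (-s) : ℂ))).congr_of_eventuallyEq
      ((isOpen_Ioo.eventually_mem hθ).mono fun t ht => e1 (s, t) ht))
  have b2 := (hasDerivAt_comp_expPolar_snd hB).unique
    ((hFt.fun_mul (((hc.fun_neg.fun_mul hsin).fun_add hcos).const_mul
      (Real.exp (-s) : ℂ))).congr_of_eventuallyEq
      ((isOpen_Ioo.eventually_mem hθ).mono fun t ht => e2 (s, t) ht))
  have hcs : (Real.sin θ : ℂ) ^ 2 + (Real.cos θ : ℂ) ^ 2 = 1 := by
    exact_mod_cast Real.sin_sq_add_cos_sq θ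
  have he : (Real.exp s : ℂ) * Real.exp (-s) = 1 := by
    rw [← Complex.ofReal_mul, ← Real.exp_add]
    simp
  unfold transpose
  generalize fderiv ℝ (fun w => L.A w * L.testOf F w) (expPolar (s, θ)) (1, 0) = A1 at *
  generalize fderiv ℝ (fun w => L.A w * L.testOf F w) (expPolar (s, θ)) (0, 1) = A2 at *
  generalize fderiv ℝ (fun w => L.B w * L.testOf F w) (expPolar (s, θ)) (1, 0) = B1 at *
  generalize fderiv ℝ (fun w => L.B w * L.testOf F w) (expPolar (s, θ)) (0, 1) = B2 at *
  generalize fderiv ℝ F (s, θ) (1, 0) = F1 at *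
  generalize fderiv ℝ F (s, θ) (0, 1) = F2 at *
  simp only [expPolar, Complex.ofReal_mul, Complex.ofReal_neg] at a1 a2 b1 b2
  generalize F (s, θ) = F0 at *
  generalize deriv L.slope θ = c' at *
  generalize L.slope θ = c at *
  generalize (Real.cos θ : ℂ) = C at *
  generalize (Real.sin θ : ℂ) = S at *
  generalize (Real.exp (-s) : ℂ) = r' at *
  rw [Complex.ofReal_pow]
  generalize (Real.exp s : ℂ) = r at *
  -- This inverts the chain rule: `r ∂x = cos θ ∂s - sin θ ∂θ` and `r ∂y = sin θ ∂s + cos θ ∂θ`. The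
  -- terms in `F0` and `c'` cancel.
  have key : r ^ 2 * (A1 + B2) * (S ^ 2 + C ^ 2) =
      r * r' * (S ^ 2 + C ^ 2) * (F2 - c * F1) := by
    linear_combination r * C * a1 - r * S * a2 + r * S * b1 + r * C * b2
  rw [hcs, he] at key
  linear_combination -key

theorem IsWeakSolution.integral_strip {u : ℝ × ℝ → ℂ} (hu : L.IsWeakSolution u)
    (hL : L.IsSmooth) (hhom : L.IsHomogeneous lam)
    (hC2 : ∀ z ∈ puncturedPlane, wedge L radial z ≠ 0) (hF : ContDiff ℝ ∞ F)
    (hc : HasCompactSupport F) (hs : tsupport F ⊆ univ ×ˢ Ioo (-Real.pi) Real.pi) :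
    ∫ w : ℝ × ℝ, u (expPolar w) *
      (fderiv ℝ F w (0, 1) - L.slope w.2 * fderiv ℝ F w (1, 0)) = 0 := by
  have h := hu (testFunction hL hC2 hF hc hs)
  change ∫ z, u z * L.transpose (L.testOf F) z = 0 at h
  rw [integral_expPolar] at h
  rw [← setIntegral_eq_integral_of_forall_compl_eq_zero
    (s := univ ×ˢ Ioo (-Real.pi) Real.pi), ← neg_eq_zero, ← integral_neg, ← h]
  · refine setIntegral_congr_fun (MeasurableSet.univ.prod measurableSet_Ioo) fun w hw => ?_
    have := transpose_testOf (s := w.1) (θ := w.2) hL hhom hC2 hF hw.2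
    simp only [Prod.mk.eta] at this ⊢
    linear_combination -u (expPolar w) * this
  · intro w hw
    have : fderiv ℝ F w = 0 := by
      by_contra hne
      exact hw (hs (support_fderiv_subset ℝ hne))
    simp [this]

end PlaneVF

/-! ### Gaussian transforms of bounded functions -/

/-- The entire Gaussian `exp (-b z ^ 2)`. -/
def gaussKernel (b : ℝ) (z : ℂ) : ℂ := Complex.exp (-b * z ^ 2)

theorem contDiff_gaussKernel (b : ℝ) {n : WithTop ℕ∞} : ContDiff ℝ n (gaussKernel b) := by
  have : ContDiff ℂ n (gaussKernel b) := by
    unfold gaussKernel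
    fun_prop
  exact this.restrict_scalars ℝ

theorem continuous_gaussKernel (b : ℝ) : Continuous (gaussKernel b) :=
  (contDiff_gaussKernel b (n := 0)).continuous

theorem hasDerivAt_gaussKernel (b : ℝ) (z : ℂ) :
    HasDerivAt (gaussKernel b) (-2 * b * z * gaussKernel b z) z := by
  have := ((hasDerivAt_pow 2 z).const_mul (-b : ℂ)).cexp
  refine this.congr_deriv ?_
  simp only [gaussKernel]
  push_cast
  ring

theorem norm_gaussKernel (b : ℝ) (z : ℂ) (s : ℝ) :
    ‖gaussKernel b (z - s)‖ = Real.exp (b * z.im ^ 2) * Real.exp (-b * (s - z.re) ^ 2) := by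
  rw [gaussKernel, Complex.norm_exp, ← Real.exp_add]
  congr 1
  simp [pow_two]
  ring

theorem norm_gaussKernel_le {b : ℝ} (hb : 0 < b) (z : ℂ) (s : ℝ) :
    ‖gaussKernel b (z - s)‖ ≤ Real.exp (b * ‖z‖ ^ 2) * Real.exp (-(b / 2) * s ^ 2) := by
  rw [norm_gaussKernel, ← Real.exp_add, ← Real.exp_add, Complex.sq_norm, Complex.normSq_apply]
  apply Real.exp_le_exp.2
  -- The two exponents differ by `(b / 2) (s - 2 Re z)²`.
  nlinarith [mul_nonneg hb.le (sq_nonneg (s - 2 * z.re))]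

/-- Convolution with the entire Gaussian. -/
def gaussTransform (b : ℝ) (f : ℝ → ℂ) (z : ℂ) : ℂ := ∫ s : ℝ, f s * gaussKernel b (z - s)

section Transform

variable {b M : ℝ} {f : ℝ → ℂ}

theorem integrable_mul_gaussKernel (hb : 0 < b) (hf : Continuous f) (hM : ∀ s, ‖f s‖ ≤ M) (z : ℂ) :
    Integrable (fun s : ℝ => f s * gaussKernel b (z - s)) := by
  refine Integrable.mono' (((integrable_exp_neg_mul_sq (half_pos hb)).const_mul
    (Real.exp (b * ‖z‖ ^ 2))).const_mul M) ?_ (ae_of_all _ fun s => ?_)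
  · exact (hf.mul ((continuous_gaussKernel b).comp (by fun_prop))).aestronglyMeasurable
  · rw [norm_mul]
    have := (norm_nonneg (f s)).trans (hM s)
    have := hM s
    gcongr
    exact norm_gaussKernel_le hb z s

theorem differentiable_gaussTransform (hb : 0 < b) (hf : Continuous f) (hM : ∀ s, ‖f s‖ ≤ M) :
    Differentiable ℂ (gaussTransform b f) := by
  intro z₀
  have hM0 : 0 ≤ M := (norm_nonneg _).trans (hM 0)
  have hcont : ∀ z : ℂ, Continuous fun s : ℝ => f s * gaussKernel b (z - s) := fun z =>
    hf.mul ((continuous_gaussKernel b).comp (by fun_prop))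
  have hi1 := (integrable_exp_neg_mul_sq (half_pos hb))
  have hi2 := (integrable_mul_exp_neg_mul_sq (half_pos hb)).norm
  refine (hasDerivAt_integral_of_dominated_loc_of_deriv_le (Metric.ball_mem_nhds z₀ one_pos)
    (F' := fun z (s : ℝ) => f s * (-2 * b * (z - s) * gaussKernel b (z - s)))
    (bound := fun s => M * (2 * b * Real.exp (b * (‖z₀‖ + 1) ^ 2) *
      ((‖z₀‖ + 1) * Real.exp (-(b / 2) * s ^ 2) + ‖s * Real.exp (-(b / 2) * s ^ 2)‖)))
    (Eventually.of_forall fun z => (hcont z).aestronglyMeasurable)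
    (integrable_mul_gaussKernel hb hf hM z₀) ?_ ?_ ?_ ?_).2.differentiableAt
  · refine Continuous.aestronglyMeasurable ?_
    exact hf.mul (Continuous.mul (by fun_prop) ((continuous_gaussKernel b).comp (by fun_prop)))
  · refine ae_of_all _ fun s z hz => ?_
    have hz' : ‖z‖ ≤ ‖z₀‖ + 1 := by
      have h1 : ‖z - z₀‖ < 1 := by simpa [dist_eq_norm] using hz
      have h2 := norm_add_le (z - z₀) z₀
      simp only [sub_add_cancel] at h2
      linarith
    have h1 : ‖z - s‖ ≤ ‖z₀‖ + 1 + |s| := by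
      have := norm_sub_le z (s : ℂ)
      rw [Complex.norm_real, Real.norm_eq_abs] at this
      linarith
    have h2 := norm_gaussKernel_le hb z s
    have h3 : Real.exp (b * ‖z‖ ^ 2) ≤ Real.exp (b * (‖z₀‖ + 1) ^ 2) := by gcongr
    have h4 := hM s
    rw [norm_mul, norm_mul, norm_mul, norm_mul, Complex.norm_real, norm_neg, Real.norm_eq_abs,
      abs_of_pos hb, Complex.norm_ofNat, norm_mul s, Real.norm_eq_abs, Real.norm_eq_abs,
      Real.abs_exp]
    calc ‖f s‖ * (2 * b * ‖z - s‖ * ‖gaussKernel b (z - s)‖)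
        ≤ M * (2 * b * (‖z₀‖ + 1 + |s|) *
          (Real.exp (b * (‖z₀‖ + 1) ^ 2) * Real.exp (-(b / 2) * s ^ 2))) := by
          gcongr
          exact h2.trans (by gcongr)
      _ = _ := by ring
  · exact (((hi1.const_mul _).add hi2).const_mul _).const_mul _
  · refine ae_of_all _ fun s z _ => ?_
    have := (hasDerivAt_gaussKernel b (z - s)).comp z ((hasDerivAt_id z).sub_const (s : ℂ))
    exact (this.const_mul (f s)).congr_deriv (by ring)

/-- The bound involves `z` only through `Im z`, so the transform is bounded on every horizontal
strip. -/
theorem norm_gaussTransform_le (hb : 0 < b) (hM : ∀ s, ‖f s‖ ≤ M) (z : ℂ) :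
    ‖gaussTransform b f z‖ ≤ M * Real.exp (b * z.im ^ 2) * √(Real.pi / b) := by
  have hi : Integrable (fun s : ℝ => Real.exp (-b * (s - z.re) ^ 2)) :=
    (integrable_exp_neg_mul_sq hb).comp_sub_right z.re
  have he : ∫ s : ℝ, Real.exp (-b * (s - z.re) ^ 2) = √(Real.pi / b) := by
    rw [integral_sub_right_eq_self (fun s : ℝ => Real.exp (-b * s ^ 2)) z.re, integral_gaussian]
  rw [← he, ← integral_const_mul]
  refine norm_integral_le_of_norm_le (hi.const_mul _) (ae_of_all _ fun s => ?_)
  rw [norm_mul, norm_gaussKernel, mul_assoc]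
  have := hM s
  gcongr

/-- Gaussians form an approximate identity: substitute `s = x + t / (n + 1)` and use dominated
convergence. -/
theorem tendsto_gaussTransform (hf : Continuous f) (hM : ∀ s, ‖f s‖ ≤ M) (x : ℝ) :
    Tendsto (fun n : ℕ => ((n : ℂ) + 1) * gaussTransform (((n : ℝ) + 1) ^ 2) f x) atTop
      (𝓝 (f x * √Real.pi)) := by
  have h1 : ∀ n : ℕ, ((n : ℂ) + 1) * gaussTransform (((n : ℝ) + 1) ^ 2) f x =
      ∫ t : ℝ, f (x + t / ((n : ℝ) + 1)) * Real.exp (-1 * t ^ 2) := by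
    intro n
    have hn : (0 : ℝ) < (n : ℝ) + 1 := by positivity
    have hn' : ((n : ℂ) + 1) ≠ 0 := by exact_mod_cast hn.ne'
    have h2 := Measure.integral_comp_mul_left
      (fun t : ℝ => f (x + t / ((n : ℝ) + 1)) * Real.exp (-1 * t ^ 2)) ((n : ℝ) + 1)
    have h3 : gaussTransform (((n : ℝ) + 1) ^ 2) f x = ∫ t : ℝ, f (x + ((n : ℝ) + 1) * t /
        ((n : ℝ) + 1)) * Real.exp (-1 * (((n : ℝ) + 1) * t) ^ 2) := by
      rw [gaussTransform, ← integral_add_left_eq_self _ x]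
      congr 1
      funext t
      rw [mul_div_cancel_left₀ _ hn.ne', gaussKernel, Complex.ofReal_exp]
      congr 2
      push_cast
      ring
    rw [h3, h2, abs_of_pos (inv_pos.2 hn), Complex.real_smul]
    push_cast
    rw [mul_inv_cancel_left₀ hn']
  simp_rw [h1]
  have h4 : f x * √Real.pi = ∫ t : ℝ, f x * Real.exp (-1 * t ^ 2) := by
    rw [integral_const_mul, integral_complex_ofReal, integral_gaussian, div_one]
  rw [h4]
  refine tendsto_integral_of_dominated_convergence (fun t => M * Real.exp (-1 * t ^ 2))
    (fun n => ?_) ((integrable_exp_neg_mul_sq one_pos).const_mul M) (fun n => ?_) ?_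
  · exact Continuous.aestronglyMeasurable (by fun_prop)
  · refine ae_of_all _ fun t => ?_
    rw [norm_mul, Complex.norm_real, Real.norm_eq_abs, Real.abs_exp]
    have := hM (x + t / ((n : ℝ) + 1))
    gcongr
  · refine ae_of_all _ fun t => Tendsto.mul_const _ ?_
    refine (hf.tendsto x).comp ?_
    have h5 : Tendsto (fun n : ℕ => t * (1 / ((n : ℝ) + 1))) atTop (𝓝 (t * 0)) :=
      tendsto_one_div_add_atTop_nhds_zero_nat.const_mul t
    have h6 := h5.const_add x
    rw [mul_zero, add_zero] at h6
    refine h6.congr fun n => ?_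
    ring

/-- A Gaussian transform of a bounded function with a non-real period is constant. -/
theorem gaussTransform_eq_of_periodic (hb : 0 < b) (hf : Continuous f) (hM : ∀ s, ‖f s‖ ≤ M)
    {τ : ℂ} (hτ : τ.im ≠ 0) (hper : Function.Periodic (gaussTransform b f) τ) (z z' : ℂ) :
    gaussTransform b f z = gaussTransform b f z' := by
  have hM0 : 0 ≤ M := (norm_nonneg _).trans (hM 0)
  refine (differentiable_gaussTransform hb hf hM).apply_eq_apply_of_bounded ?_ z z'
  refine (isBounded_iff_forall_norm_le.2
    ⟨M * Real.exp (b * τ.im ^ 2) * √(Real.pi / b), ?_⟩)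
  rintro _ ⟨ζ, rfl⟩
  -- Translating by a multiple of `τ` brings `Im ζ` to a fractional part times `Im τ`, hence into a
  -- fixed strip.
  rw [← hper.sub_zsmul_eq ⌊ζ.im / τ.im⌋]
  refine (norm_gaussTransform_le hb hM _).trans ?_
  have h : (ζ - ⌊ζ.im / τ.im⌋ • τ).im = Int.fract (ζ.im / τ.im) * τ.im := by
    rw [← Int.self_sub_floor, sub_mul, div_mul_cancel₀ _ hτ]
    simp
  rw [h, mul_pow]
  have h1 : Int.fract (ζ.im / τ.im) ^ 2 ≤ 1 :=
    pow_le_one₀ (Int.fract_nonneg _) (Int.fract_lt_one _).le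
  gcongr
  exact mul_le_of_le_one_left (sq_nonneg _) h1

end Transform

/-! ### The du Bois-Reymond lemma -/

/-- A continuous function whose distributional derivative vanishes is constant. -/
theorem eqOn_of_integral_deriv_mul_eq_zero {a b : ℝ} (hab : a < b) {H : ℝ → ℂ} (hH : Continuous H)
    (h : ∀ χ : ℝ → ℝ, ContDiff ℝ ∞ χ → HasCompactSupport χ → tsupport χ ⊆ Ioo a b →
      ∫ x, ((deriv χ x : ℝ) : ℂ) * H x = 0) : ∀ x ∈ Icc a b, H x = H a := by
  obtain ⟨r, hr, hrb⟩ : ∃ r, 0 < r ∧ Metric.closedBall ((a + b) / 2) r ⊆ Ioo a b := by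
    refine ⟨(b - a) / 4, by linarith, ?_⟩
    rw [Real.closedBall_eq_Icc]
    exact Icc_subset_Ioo (by linarith) (by linarith)
  let B : ContDiffBump ((a + b) / 2) := ⟨r / 2, r, half_pos hr, half_lt_self hr⟩
  let η : ℝ → ℝ := B.normed volume
  have hη1 : ∫ x, η x = 1 := B.integral_normed
  have hηs : ContDiff ℝ ∞ η := B.contDiff_normed
  have hηc : HasCompactSupport η := B.hasCompactSupport_normed
  have hηt : tsupport η ⊆ Ioo a b := by
    rw [B.tsupport_normed_eq]
    exact hrb
  have hcint : ∀ g : ℝ → ℝ, Continuous g → HasCompactSupport g →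
      Integrable fun x => (g x : ℂ) * H x := by
    intro g hg hgc
    refine Continuous.integrable_of_hasCompactSupport (by fun_prop) ?_
    have : HasCompactSupport fun x => (g x : ℂ) := hgc.comp_left (g := Complex.ofReal) rfl
    exact this.mul_right
  have hae := isOpen_Ioo.ae_eq_zero_of_integral_contDiff_smul_eq_zero (μ := volume)
    (U := Ioo a b) (f := fun x => H x - ∫ y, (η y : ℂ) * H y)
    ((hH.sub continuous_const).locallyIntegrable.locallyIntegrableOn _) (by
    intro g hg hgc hgt
    set m := ∫ x, g x with hm
    -- Subtracting `m η` makes the mean zero, so the primitive `χ` of `k` has compact support and is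
    -- an admissible test function.
    let k : ℝ → ℝ := fun x => g x - m * η x
    have hk : ContDiff ℝ ∞ k := hg.sub (contDiff_const.mul hηs)
    let χ : ℝ → ℝ := fun x => ∫ t in a..x, k t
    have hχ : ∀ x, HasDerivAt χ (k x) x := fun x =>
      intervalIntegral.integral_hasDerivAt_right (hk.continuous.intervalIntegrable _ _)
        (hk.continuous.stronglyMeasurableAtFilter _ _) hk.continuous.continuousAt
    have hd : deriv χ = k := funext fun x => (hχ x).deriv
    have hχs : ContDiff ℝ ∞ χ := contDiff_infty_iff_deriv.2
      ⟨fun x => (hχ x).differentiableAt, hd ▸ hk⟩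
    obtain ⟨a', b', ha', hb', hK⟩ : ∃ a' b', a < a' ∧ b' < b ∧
        tsupport g ∪ tsupport η ⊆ Icc a' b' := by
      have hKc : IsCompact (tsupport g ∪ tsupport η) := hgc.isCompact.union hηc.isCompact
      have hKn : (tsupport g ∪ tsupport η).Nonempty := by
        refine ⟨(a + b) / 2, Or.inr ?_⟩
        rw [B.tsupport_normed_eq]
        exact Metric.mem_closedBall_self hr.le
      have hsub : tsupport g ∪ tsupport η ⊆ Ioo a b := union_subset hgt hηt
      exact ⟨_, _, (hsub (hKc.sInf_mem hKn)).1, (hsub (hKc.sSup_mem hKn)).2,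
        fun x hx => ⟨csInf_le hKc.bddBelow hx, le_csSup hKc.bddAbove hx⟩⟩
    have hk0 : ∀ x, x ∉ Icc a' b' → k x = 0 := by
      intro x hx
      have h1 : g x = 0 := image_eq_zero_of_notMem_tsupport fun h => hx (hK (Or.inl h))
      have h2 : η x = 0 := image_eq_zero_of_notMem_tsupport fun h => hx (hK (Or.inr h))
      simp [k, h1, h2]
    have hgi : Integrable g := hg.continuous.integrable_of_hasCompactSupport hgc
    have hgi' : Integrable fun x => (g x : ℂ) := hgi.ofReal
    have hηi : Integrable η := hηs.continuous.integrable_of_hasCompactSupport hηc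
    have hktot : ∫ x, k x = 0 := by
      simp only [k]
      rw [integral_sub hgi (hηi.const_mul m), integral_const_mul, hη1]
      simp [hm]
    have hχ0 : ∀ x, x ∉ Icc a' b' → χ x = 0 := by
      intro x hx
      rw [mem_Icc, not_and_or, not_le, not_le] at hx
      rcases hx with hx | hx
      · refine intervalIntegral.integral_zero_ae (ae_of_all _ fun t ht => hk0 t fun h => ?_)
        have := (mem_uIoc.1 ht)
        rcases this with h' | h' <;> linarith [h.1, h'.1, h'.2]
      · rw [← hktot]
        refine intervalIntegral.integral_eq_integral_of_support_subset fun t ht => ?_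
        have h' : t ∈ Icc a' b' := by
          by_contra h'
          exact ht (hk0 t h')
        exact ⟨by linarith [h'.1], by linarith [h'.2]⟩
    have hχt : tsupport χ ⊆ Icc a' b' := closure_minimal
      (fun x hx => by
        by_contra h'
        exact hx (hχ0 x h')) isClosed_Icc
    have hχc : HasCompactSupport χ := isCompact_Icc.of_isClosed_subset (isClosed_tsupport _) hχt
    have h0 := h χ hχs hχc (hχt.trans (Icc_subset_Ioo ha' hb'))
    rw [hd] at h0
    have e1 : ∀ x, (k x : ℂ) * H x = (g x : ℂ) * H x - m * ((η x : ℂ) * H x) := by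
      intro x
      simp only [k]
      push_cast
      ring
    simp_rw [e1] at h0
    rw [integral_sub (hcint g hg.continuous hgc) ((hcint η hηs.continuous hηc).const_mul _),
      integral_const_mul] at h0
    simp_rw [smul_sub, Complex.real_smul]
    rw [integral_sub (hcint g hg.continuous hgc) (hgi'.mul_const _), integral_mul_const,
      integral_complex_ofReal]
    exact h0)
  -- Continuity upgrades almost-everywhere equality to the closed interval; the endpoints are needed
  -- later for gluing.
  have hEq := Measure.eqOn_Icc_of_ae_eq (μ := volume) (a := a) (b := b) hab.ne
    (f := H) (g := fun _ => ∫ y, (η y : ℂ) * H y) (by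
      rw [restrict_Ioo_eq_restrict_Icc.symm]
      rw [EventuallyEq, ae_restrict_iff' measurableSet_Ioo]
      filter_upwards [hae] with x hx hx'
      exact sub_eq_zero.1 (hx hx')) hH.continuousOn continuousOn_const
  intro x hx
  rw [hEq hx, hEq (left_mem_Icc.2 hab.le)]

/-! ### The transport equation on the strip -/

section Cylinder

variable {c : ℝ → ℂ} {v : ℝ × ℝ → ℂ} {b M : ℝ}

/-- The primitive of `c` that vanishes at `0`. -/
def primitive (c : ℝ → ℂ) (θ : ℝ) : ℂ := ∫ t in (0 : ℝ)..θ, c t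

theorem hasDerivAt_primitive (hc : Continuous c) (θ : ℝ) : HasDerivAt (primitive c) (c θ) θ :=
  intervalIntegral.integral_hasDerivAt_right (hc.intervalIntegrable _ _)
    (hc.stronglyMeasurableAtFilter _ _) hc.continuousAt

theorem contDiff_primitive (hc : ContDiff ℝ ∞ c) : ContDiff ℝ ∞ (primitive c) := by
  have hd : deriv (primitive c) = c := funext fun x => (hasDerivAt_primitive hc.continuous x).deriv
  exact contDiff_infty_iff_deriv.2
    ⟨fun x => (hasDerivAt_primitive hc.continuous x).differentiableAt, by rwa [hd]⟩

theorem continuous_gaussTransform_slices (hb : 0 < b) (hv : Continuous v) (hM : ∀ w, ‖v w‖ ≤ M)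
    {ζ : ℝ → ℂ} (hζ : Continuous ζ) :
    Continuous fun θ => gaussTransform b (fun s => v (s, θ)) (ζ θ) := by
  have hM0 : 0 ≤ M := (norm_nonneg _).trans (hM 0)
  refine continuous_iff_continuousAt.2 fun θ₀ => ?_
  refine continuousAt_of_dominated
    (bound := fun s => M * (Real.exp (b * (‖ζ θ₀‖ + 1) ^ 2) * Real.exp (-(b / 2) * s ^ 2)))
    (Eventually.of_forall fun θ => ?_) ?_
    (((integrable_exp_neg_mul_sq (half_pos hb)).const_mul _).const_mul _)
    (ae_of_all _ fun s => ?_)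
  · exact ((hv.comp (by fun_prop)).mul
      ((continuous_gaussKernel b).comp (by fun_prop))).aestronglyMeasurable
  · have : ∀ᶠ θ in 𝓝 θ₀, ‖ζ θ‖ < ‖ζ θ₀‖ + 1 :=
      hζ.norm.continuousAt.eventually_lt continuousAt_const (by simp)
    filter_upwards [this] with θ hθ
    refine ae_of_all _ fun s => ?_
    rw [norm_mul]
    have := hM (s, θ)
    gcongr
    exact (norm_gaussKernel_le hb _ s).trans (by gcongr)
  · exact ((hv.comp (by fun_prop)).mul
      ((continuous_gaussKernel b).comp (by fun_prop))).continuousAt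

/-- `v` solves `∂θ v = c(θ) ∂s v` weakly on `ℝ × (-π, π)`. -/
def IsWeakTransport (c : ℝ → ℂ) (v : ℝ × ℝ → ℂ) : Prop :=
  ∀ F : ℝ × ℝ → ℂ, ContDiff ℝ ∞ F → HasCompactSupport F →
    tsupport F ⊆ univ ×ˢ Ioo (-Real.pi) Real.pi →
      ∫ w : ℝ × ℝ, v w * (fderiv ℝ F w (0, 1) - c w.2 * fderiv ℝ F w (1, 0)) = 0

theorem fderiv_fst_snd_of_hasDerivAt {F : ℝ × ℝ → ℂ} {w : ℝ × ℝ} {a a' : ℂ}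
    (hF : DifferentiableAt ℝ F w) (h1 : HasDerivAt (fun t => F (t, w.2)) a w.1)
    (h2 : HasDerivAt (fun t => F (w.1, t)) a' w.2) :
    fderiv ℝ F w (1, 0) = a ∧ fderiv ℝ F w (0, 1) = a' := by
  constructor
  · exact (hF.hasFDerivAt.comp_hasDerivAt w.1
      ((hasDerivAt_id w.1).prodMk (hasDerivAt_const w.1 w.2))).unique h1
  · exact (hF.hasFDerivAt.comp_hasDerivAt w.2
      ((hasDerivAt_const w.2 w.1).prodMk (hasDerivAt_id w.2))).unique h2

/-- The kernel `G = gaussKernel b (z - C(θ) - s)` is annihilated by `∂θ - c ∂s`, so testing against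
`χ(θ) G` leaves only `χ'`. As `G` is not compactly supported in `s`, a cutoff `ρ(s / (n + 1))` is
inserted; its derivative carries a factor `1 / (n + 1)` and disappears in the limit. -/
theorem IsWeakTransport.integral_deriv_mul_eq_zero (hw : IsWeakTransport c v) (hb : 0 < b)
    (hc : ContDiff ℝ ∞ c) (hv : Continuous v) (hM : ∀ w, ‖v w‖ ≤ M) (z : ℂ)
    {χ : ℝ → ℝ} (hχ : ContDiff ℝ ∞ χ) (hχc : HasCompactSupport χ)
    (hχt : tsupport χ ⊆ Ioo (-Real.pi) Real.pi) :
    ∫ θ, ((deriv χ θ : ℝ) : ℂ) *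
      gaussTransform b (fun s => v (s, θ)) (z - primitive c θ) = 0 := by
  have hM0 : 0 ≤ M := (norm_nonneg _).trans (hM 0)
  have hC := contDiff_primitive hc
  let B : ContDiffBump (0 : ℝ) := ⟨1, 2, one_pos, one_lt_two⟩
  let ρ : ℝ → ℝ := B
  have hρ : ContDiff ℝ ∞ ρ := B.contDiff
  have hρc : HasCompactSupport ρ := B.hasCompactSupport
  have hρ' : Continuous (deriv ρ) := hρ.continuous_deriv (by simp)
  have hχ' : Continuous (deriv χ) := hχ.continuous_deriv (by simp)
  have hχd : ∀ θ, HasDerivAt χ (deriv χ θ) θ := fun θ =>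
    (hχ.contDiffAt.differentiableAt (by simp)).hasDerivAt
  have hρd : ∀ θ, HasDerivAt ρ (deriv ρ θ) θ := fun θ =>
    (hρ.contDiffAt.differentiableAt (by simp)).hasDerivAt
  obtain ⟨R, hR⟩ := hρ'.bounded_above_of_compact_support hρc.deriv
  have hR0 : 0 ≤ R := (norm_nonneg _).trans (hR 0)
  let G : ℝ × ℝ → ℂ := fun w => gaussKernel b (z - primitive c w.2 - w.1)
  have hG : ContDiff ℝ ∞ G := (contDiff_gaussKernel b).comp
    ((contDiff_const.sub (hC.comp contDiff_snd)).sub (Complex.ofRealCLM.contDiff.comp contDiff_fst))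
  let F : ℕ → ℝ × ℝ → ℂ := fun n w => χ w.2 * ρ (w.1 * (1 / ((n : ℝ) + 1))) * G w
  have hF : ∀ n, ContDiff ℝ ∞ (F n) := fun n =>
    ((Complex.ofRealCLM.contDiff.comp (hχ.comp contDiff_snd)).mul
      (Complex.ofRealCLM.contDiff.comp (hρ.comp (contDiff_fst.mul contDiff_const)))).mul hG
  have hFt : ∀ n, tsupport (F n) ⊆
      Icc (-(2 * ((n : ℝ) + 1))) (2 * ((n : ℝ) + 1)) ×ˢ tsupport χ := by
    intro n
    refine closure_minimal ?_ (isClosed_Icc.prod (isClosed_tsupport _))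
    intro w hw
    have hn : (0 : ℝ) < (n : ℝ) + 1 := by positivity
    refine ⟨?_, subset_tsupport _ fun h => hw (by simp [F, h])⟩
    have h1 : ρ (w.1 * (1 / ((n : ℝ) + 1))) ≠ 0 := fun h =>
      hw (by simp only [F, h, Complex.ofReal_zero, mul_zero, zero_mul])
    have h2 : w.1 * (1 / ((n : ℝ) + 1)) ∈ Metric.ball (0 : ℝ) 2 := by
      rw [← B.support_eq]
      exact h1
    rw [mem_ball_zero_iff, Real.norm_eq_abs, mul_one_div, abs_div, abs_of_pos hn,
      div_lt_iff₀ hn] at h2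
    exact abs_le.1 h2.le
  have hFc : ∀ n, HasCompactSupport (F n) := fun n =>
    (isCompact_Icc.prod hχc.isCompact).of_isClosed_subset (isClosed_tsupport _) (hFt n)
  have hFd : ∀ n w, fderiv ℝ (F n) w (0, 1) - c w.2 * fderiv ℝ (F n) w (1, 0) =
      ((deriv χ w.2 : ℝ) : ℂ) * ρ (w.1 * (1 / ((n : ℝ) + 1))) * G w -
        c w.2 * (χ w.2 * (((deriv ρ (w.1 * (1 / ((n : ℝ) + 1))) : ℝ) : ℂ) *
          ((1 / ((n : ℝ) + 1) : ℝ) : ℂ)) * G w) := by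
    intro n w
    have hK := hasDerivAt_gaussKernel b (z - primitive c w.2 - w.1)
    have h1 : HasDerivAt (fun t : ℝ => gaussKernel b (z - primitive c w.2 - t)) _ w.1 :=
      hK.comp_of_eq w.1 ((hasDerivAt_id w.1).ofReal_comp.const_sub (z - primitive c w.2)) rfl
    have h2 : HasDerivAt (fun t : ℝ => gaussKernel b (z - primitive c t - w.1)) _ w.2 :=
      hK.comp_of_eq w.2 (((hasDerivAt_primitive hc.continuous w.2).const_sub z).sub_const
        (w.1 : ℂ)) rfl
    have h3 : HasDerivAt (fun t : ℝ => ρ (t * (1 / ((n : ℝ) + 1)))) _ w.1 :=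
      (hρd _).comp_of_eq w.1 ((hasDerivAt_id w.1).mul_const (1 / ((n : ℝ) + 1))) rfl
    obtain ⟨e1, e2⟩ := fderiv_fst_snd_of_hasDerivAt ((hF n).contDiffAt.differentiableAt (by simp))
      ((h3.ofReal_comp.const_mul (χ w.2 : ℂ)).fun_mul h1)
      (((hχd w.2).ofReal_comp.mul_const (ρ (w.1 * (1 / ((n : ℝ) + 1))) : ℂ)).fun_mul h2)
    rw [e1, e2]
    simp only [G]
    push_cast
    ring
  have hzero : ∀ n : ℕ, ∫ w, v w * (((deriv χ w.2 : ℝ) : ℂ) * ρ (w.1 * (1 / ((n : ℝ) + 1))) * G w -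
        c w.2 * (χ w.2 * (((deriv ρ (w.1 * (1 / ((n : ℝ) + 1))) : ℝ) : ℂ) *
          ((1 / ((n : ℝ) + 1) : ℝ) : ℂ)) * G w)) = 0 := by
    intro n
    rw [← hw (F n) (hF n) (hFc n) ((hFt n).trans (prod_mono (subset_univ _) hχt))]
    simp_rw [hFd]
  -- The `θ`-factor of the dominating function, uniform in `n` because `|ρ| ≤ 1`, `|ρ'| ≤ R` and `1
  -- / (n + 1) ≤ 1`.
  let ψ : ℝ → ℝ := fun θ => (|deriv χ θ| + ‖c θ‖ * |χ θ| * R) *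
    Real.exp (b * ‖z - primitive c θ‖ ^ 2)
  have hψ : Integrable ψ := by
    have hcc := hc.continuous
    have hCc := hC.continuous
    have hχcc := hχ.continuous
    refine Continuous.integrable_of_hasCompactSupport (by fun_prop) ?_
    refine hχc.mono' (fun θ hθ => ?_)
    by_contra h
    apply hθ
    have h' : deriv χ θ = 0 :=
      image_eq_zero_of_notMem_tsupport fun h' => h (tsupport_deriv_subset h')
    simp [ψ, image_eq_zero_of_notMem_tsupport h, h']
  have hbound : Integrable (fun w : ℝ × ℝ => M * (Real.exp (-(b / 2) * w.1 ^ 2) * ψ w.2)) :=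
    ((integrable_exp_neg_mul_sq (half_pos hb)).mul_prod hψ).const_mul M
  have hGle : ∀ w, ‖G w‖ ≤ Real.exp (b * ‖z - primitive c w.2‖ ^ 2) *
      Real.exp (-(b / 2) * w.1 ^ 2) := fun w => norm_gaussKernel_le hb _ _
  have hlim := tendsto_integral_of_dominated_convergence (μ := volume)
    (F := fun (n : ℕ) w => v w * (((deriv χ w.2 : ℝ) : ℂ) * ρ (w.1 * (1 / ((n : ℝ) + 1))) * G w -
        c w.2 * (χ w.2 * (((deriv ρ (w.1 * (1 / ((n : ℝ) + 1))) : ℝ) : ℂ) *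
          ((1 / ((n : ℝ) + 1) : ℝ) : ℂ)) * G w)))
    (f := fun w => v w * (((deriv χ w.2 : ℝ) : ℂ) * G w))
    (fun w : ℝ × ℝ => M * (Real.exp (-(b / 2) * w.1 ^ 2) * ψ w.2)) ?_ hbound ?_ ?_
  · simp_rw [hzero] at hlim
    have h0 := tendsto_nhds_unique hlim tendsto_const_nhds
    rw [Measure.volume_eq_prod, integral_prod_symm] at h0
    · rw [← h0]
      congr 1
      funext θ
      rw [gaussTransform, ← integral_const_mul]
      congr 1
      funext s
      simp only [G]
      ring
    · rw [← Measure.volume_eq_prod]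
      refine hbound.mono' ?_ (ae_of_all _ fun w => ?_)
      · have := hG.continuous
        exact Continuous.aestronglyMeasurable (by fun_prop)
      · rw [norm_mul, norm_mul, Complex.norm_real, Real.norm_eq_abs]
        calc ‖v w‖ * (|deriv χ w.2| * ‖G w‖) ≤ M * (|deriv χ w.2| *
              (Real.exp (b * ‖z - primitive c w.2‖ ^ 2) * Real.exp (-(b / 2) * w.1 ^ 2))) := by
              gcongr
              exacts [hM w, hGle w]
          _ ≤ M * ((|deriv χ w.2| + ‖c w.2‖ * |χ w.2| * R) *
              (Real.exp (b * ‖z - primitive c w.2‖ ^ 2) * Real.exp (-(b / 2) * w.1 ^ 2))) := by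
              gcongr
              exact le_add_of_nonneg_right (by positivity)
          _ = _ := by ring
  · intro n
    have := hG.continuous
    have := hρ.continuous
    have := hχ.continuous
    have := hc.continuous
    exact Continuous.aestronglyMeasurable (by fun_prop)
  · intro n
    refine ae_of_all _ fun w => ?_
    have hn : (0 : ℝ) < (n : ℝ) + 1 := by positivity
    have hn1 : |1 / ((n : ℝ) + 1)| ≤ 1 := by
      rw [abs_of_pos (by positivity), div_le_one hn]
      linarith [(n.cast_nonneg : (0 : ℝ) ≤ n)]
    have hρ1 : |ρ (w.1 * (1 / ((n : ℝ) + 1)))| ≤ 1 := by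
      rw [abs_of_nonneg B.nonneg]
      exact B.le_one
    have hR1 := hR (w.1 * (1 / ((n : ℝ) + 1)))
    rw [Real.norm_eq_abs] at hR1
    calc _ ≤ ‖v w‖ * (|deriv χ w.2| * |ρ (w.1 * (1 / ((n : ℝ) + 1)))| * ‖G w‖ +
          ‖c w.2‖ * (|χ w.2| * (|deriv ρ (w.1 * (1 / ((n : ℝ) + 1)))| *
            |1 / ((n : ℝ) + 1)|) * ‖G w‖)) := by
          rw [norm_mul]
          gcongr
          refine (norm_sub_le _ _).trans (le_of_eq ?_)
          simp only [norm_mul, Complex.norm_real, Real.norm_eq_abs]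
      _ ≤ M * (|deriv χ w.2| * 1 * (Real.exp (b * ‖z - primitive c w.2‖ ^ 2) *
            Real.exp (-(b / 2) * w.1 ^ 2)) +
          ‖c w.2‖ * (|χ w.2| * (R * 1) * (Real.exp (b * ‖z - primitive c w.2‖ ^ 2) *
            Real.exp (-(b / 2) * w.1 ^ 2)))) := by
          gcongr
          exacts [hM w, hGle w, hGle w]
      _ = _ := by
          simp only [ψ]
          ring
  · refine ae_of_all _ fun w => ?_
    have ht0 : Tendsto (fun n : ℕ => 1 / ((n : ℝ) + 1)) atTop (𝓝 0) :=
      tendsto_one_div_add_atTop_nhds_zero_nat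
    have ht : Tendsto (fun n : ℕ => w.1 * (1 / ((n : ℝ) + 1))) atTop (𝓝 0) := by
      simpa using ht0.const_mul w.1
    have h1 : Tendsto (fun n : ℕ => (ρ (w.1 * (1 / ((n : ℝ) + 1))) : ℂ)) atTop (𝓝 (1 : ℝ)) := by
      have e : ρ 0 = 1 := B.one_of_mem_closedBall (Metric.mem_closedBall_self one_pos.le)
      have h := (Complex.continuous_ofReal.tendsto _).comp ((hρ.continuous.tendsto 0).comp ht)
      rwa [e] at h
    have h2 : Tendsto (fun n : ℕ => ((deriv ρ (w.1 * (1 / ((n : ℝ) + 1))) : ℝ) : ℂ)) atTop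
        (𝓝 (deriv ρ 0 : ℝ)) :=
      (Complex.continuous_ofReal.tendsto _).comp ((hρ'.tendsto 0).comp ht)
    have h3 : Tendsto (fun n : ℕ => ((1 / ((n : ℝ) + 1) : ℝ) : ℂ)) atTop (𝓝 (0 : ℝ)) :=
      (Complex.continuous_ofReal.tendsto _).comp ht0
    have h4 := (((h1.const_mul ((deriv χ w.2 : ℝ) : ℂ)).mul_const (G w)).sub
      ((((h2.mul h3).const_mul (χ w.2 : ℂ)).mul_const (G w)).const_mul (c w.2))).const_mul (v w)
    simpa using h4

/-- Bounded weak solutions of `∂θ v = c(θ) ∂s v` whose two boundary slices agree are constant if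
the mean of `c` is not real. -/
theorem IsWeakTransport.eq_const (hw : IsWeakTransport c v) (hc : ContDiff ℝ ∞ c)
    (hv : Continuous v) (hM : ∀ w, ‖v w‖ ≤ M) (hper : ∀ s, v (s, Real.pi) = v (s, -Real.pi))
    (him : (primitive c Real.pi - primitive c (-Real.pi)).im ≠ 0) :
    ∃ k, ∀ s, ∀ θ ∈ Icc (-Real.pi) Real.pi, v (s, θ) = k := by
  have hpi : -Real.pi < Real.pi := by linarith [Real.pi_pos]
  have hslice : ∀ θ, Continuous fun s => v (s, θ) := fun θ => hv.comp (by fun_prop)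
  have hMs : ∀ θ s, ‖v (s, θ)‖ ≤ M := fun θ s => hM _
  have key : ∀ b : ℝ, 0 < b → ∀ z : ℂ, ∀ θ ∈ Icc (-Real.pi) Real.pi,
      gaussTransform b (fun s => v (s, θ)) z = gaussTransform b (fun s => v (s, -Real.pi)) 0 := by
    intro b hb
    have hconst : ∀ z, ∀ θ ∈ Icc (-Real.pi) Real.pi,
        gaussTransform b (fun s => v (s, θ)) (z - primitive c θ) =
          gaussTransform b (fun s => v (s, -Real.pi)) (z - primitive c (-Real.pi)) := fun z =>
      eqOn_of_integral_deriv_mul_eq_zero hpi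
        (continuous_gaussTransform_slices hb hv hM
          (continuous_const.sub (contDiff_primitive hc).continuous))
        fun χ h1 h2 h3 => hw.integral_deriv_mul_eq_zero hb hc hv hM z h1 h2 h3
    -- Comparing the slices at `π` and `-π`, which agree, turns independence of `θ` into a period.
    have hp : Function.Periodic (gaussTransform b fun s => v (s, -Real.pi))
        (primitive c Real.pi - primitive c (-Real.pi)) := by
      intro z
      have h := hconst (z + primitive c Real.pi) Real.pi (right_mem_Icc.2 hpi.le)
      simp_rw [hper, add_sub_cancel_right] at h
      rw [h, add_sub_assoc]
    intro z θ hθ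
    have h := hconst (z + primitive c θ) θ hθ
    rw [add_sub_cancel_right] at h
    rw [h]
    exact gaussTransform_eq_of_periodic hb (hslice _) (hMs _) him hp _ _
  refine ⟨v (0, -Real.pi), fun s θ hθ => ?_⟩
  -- With `b = (n + 1)²`, both sequences coincide by `key`, so their limits `√π v(s, θ)` and `√π
  -- v(0, -π)` agree.
  have h1 := tendsto_gaussTransform (hslice θ) (hMs θ) s
  have h2 := tendsto_gaussTransform (hslice (-Real.pi)) (hMs (-Real.pi)) 0
  have h3 : ∀ n : ℕ, (0 : ℝ) < ((n : ℝ) + 1) ^ 2 := fun n => by positivity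
  simp_rw [fun n => key _ (h3 n) s θ hθ] at h1
  simp_rw [Complex.ofReal_zero] at h2
  have h4 := tendsto_nhds_unique h1 h2
  have h5 : ((√Real.pi : ℝ) : ℂ) ≠ 0 := by
    exact_mod_cast (Real.sqrt_pos.2 Real.pi_pos).ne'
  exact mul_right_cancel₀ h5 h4

end Cylinder

/-! ### Descent of periodic functions and integration by parts -/

theorem primitive_sub_of_periodic {c : ℝ → ℂ} (hc : Continuous c)
    (hper : Function.Periodic c (2 * Real.pi)) (θ : ℝ) :
    primitive c (θ + 2 * Real.pi) - primitive c θ = ∫ t in (0 : ℝ)..(2 * Real.pi), c t := by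
  unfold primitive
  rw [intervalIntegral.integral_interval_sub_left (hc.intervalIntegrable _ _)
    (hc.intervalIntegrable _ _), hper.intervalIntegral_add_eq θ 0, zero_add]

theorem comp_logPolar_expPolar {U : ℝ × ℝ → ℂ}
    (hU : ∀ s, Function.Periodic (fun θ => U (s, θ)) (2 * Real.pi)) (w : ℝ × ℝ) :
    U (logPolar (expPolar w)) = U w := by
  have h : Complex.exp (toComplex (logPolar (expPolar w))) = Complex.exp (toComplex w) := by
    rw [toComplex_logPolar, Complex.exp_log (toComplex_ne_zero (expPolar_ne_zero w)),
      toComplex_expPolar]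
  obtain ⟨k, hk⟩ := Complex.exp_eq_exp_iff_exists_int.1 h
  have e : logPolar (expPolar w) = (w.1, w.2 + k * (2 * Real.pi)) := by
    apply toComplex_injective
    rw [hk]
    apply Complex.ext <;> simp [toComplex_re, toComplex_im]
  rw [e]
  exact (hU w.1).int_mul k w.2

/-- Near `z` the branch `log z + log (y / z)` is smooth even on the cut; it differs from `logPolar`
by multiples of `2π` in the angle, which `U` does not see. -/
theorem contDiffAt_comp_logPolar {U : ℝ × ℝ → ℂ}
    (hU : ∀ s, Function.Periodic (fun θ => U (s, θ)) (2 * Real.pi)) (hs : ContDiff ℝ ∞ U)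
    {z : ℝ × ℝ} (hz : z ≠ 0) : ContDiffAt ℝ ∞ (fun y => U (logPolar y)) z := by
  have hz' := toComplex_ne_zero hz
  let g : ℝ × ℝ → ℝ × ℝ := fun y => Complex.equivRealProdCLM
    (Complex.log (toComplex z) + Complex.log (toComplex y / toComplex z))
  have hlog : ContDiffAt ℝ ∞ Complex.log (toComplex z / toComplex z) := by
    refine (Complex.contDiffAt_log ?_).restrict_scalars ℝ
    rw [div_self hz']
    exact Complex.one_mem_slitPlane
  have hdiv : ContDiffAt ℝ ∞ (fun y => toComplex y / toComplex z) z := by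
    simp_rw [div_eq_mul_inv]
    exact (contDiff_toComplex.mul contDiff_const).contDiffAt
  have hg : ContDiffAt ℝ ∞ g z := Complex.equivRealProdCLM.contDiff.contDiffAt.comp z
    (contDiffAt_const.add (ContDiffAt.comp (g := Complex.log) z hlog hdiv))
  refine (hs.contDiffAt.comp z hg).congr_of_eventuallyEq ?_
  filter_upwards [isOpen_ne.mem_nhds hz] with y hy
  have hy' := toComplex_ne_zero hy
  have e : expPolar (g y) = y := by
    apply toComplex_injective
    rw [toComplex_expPolar]
    have : toComplex (g y) =
        Complex.log (toComplex z) + Complex.log (toComplex y / toComplex z) :=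
      Complex.equivRealProdCLM.symm_apply_apply _
    rw [this, Complex.exp_add, Complex.exp_log hz', Complex.exp_log (div_ne_zero hy' hz'),
      mul_div_cancel₀ _ hz']
  have := comp_logPolar_expPolar hU (g y)
  rw [e] at this
  exact this

theorem continuous_mul_of_tsupport_subset {f g : ℝ × ℝ → ℂ} {Ω : Set (ℝ × ℝ)} (hΩ : IsOpen Ω)
    (hf : ContinuousOn f Ω) (hg : Continuous g) (hgΩ : tsupport g ⊆ Ω) :
    Continuous fun z => f z * g z := by
  refine continuous_iff_continuousAt.2 fun z => ?_
  by_cases hz : z ∈ tsupport g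
  · exact (hf.continuousAt (hΩ.mem_nhds (hgΩ hz))).mul hg.continuousAt
  · refine continuousAt_const (y := (0 : ℂ)) |>.congr ?_
    filter_upwards [notMem_tsupport_iff_eventuallyEq.1 hz] with y hy
    simp [hy]

theorem contDiff_mul_of_tsupport_subset {f g : ℝ × ℝ → ℂ} {Ω : Set (ℝ × ℝ)} (hΩ : IsOpen Ω)
    (hf : ContDiffOn ℝ ∞ f Ω) (hg : ContDiff ℝ ∞ g) (hgΩ : tsupport g ⊆ Ω) :
    ContDiff ℝ ∞ fun z => f z * g z := by
  refine contDiff_iff_contDiffAt.2 fun z => ?_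
  by_cases hz : z ∈ tsupport g
  · exact (hf.contDiffAt (hΩ.mem_nhds (hgΩ hz))).mul hg.contDiffAt
  · refine (contDiffAt_const (c := (0 : ℂ))).congr_of_eventuallyEq ?_
    filter_upwards [notMem_tsupport_iff_eventuallyEq.1 hz] with y hy
    simp [hy]

/-- Integration by parts against a function compactly supported in an open set. -/
theorem integrable_and_integral_mul_fderiv {u g : ℝ × ℝ → ℂ} {Ω : Set (ℝ × ℝ)} (hΩ : IsOpen Ω)
    (hu : ContDiffOn ℝ ∞ u Ω) (hg : ContDiff ℝ ∞ g) (hgc : HasCompactSupport g)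
    (hgΩ : tsupport g ⊆ Ω) (e : ℝ × ℝ) :
    Integrable (fun z => u z * fderiv ℝ g z e) ∧ Integrable (fun z => fderiv ℝ u z e * g z) ∧
      ∫ z, u z * fderiv ℝ g z e = -∫ z, fderiv ℝ u z e * g z := by
  have hu' : ContinuousOn (fun z => fderiv ℝ u z e) Ω :=
    (hu.continuousOn_fderiv_of_isOpen hΩ (by simp)).clm_apply continuousOn_const
  have hg' : Continuous fun z => fderiv ℝ g z e :=
    (hg.continuous_fderiv (by simp)).clm_apply continuous_const
  have hgc' : HasCompactSupport fun z => fderiv ℝ g z e := hgc.fderiv_apply ℝ e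
  have hgt' : (tsupport fun z => fderiv ℝ g z e) ⊆ Ω :=
    (tsupport_fderiv_apply_subset ℝ e).trans hgΩ
  have i1 : Integrable fun z => u z * fderiv ℝ g z e :=
    (continuous_mul_of_tsupport_subset hΩ hu.continuousOn hg' hgt').integrable_of_hasCompactSupport
      hgc'.mul_left
  have i2 : Integrable fun z => fderiv ℝ u z e * g z :=
    (continuous_mul_of_tsupport_subset hΩ hu' hg.continuous hgΩ).integrable_of_hasCompactSupport
      hgc.mul_left
  have i3 : Integrable fun z => u z * g z :=
    (continuous_mul_of_tsupport_subset hΩ hu.continuousOn hg.continuous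
      hgΩ).integrable_of_hasCompactSupport hgc.mul_left
  exact ⟨i1, i2, integral_mul_fderiv_eq_neg_fderiv_mul_of_integrable i2 i1 i3
    (fun z hz => (hu.contDiffAt (hΩ.mem_nhds (hgΩ hz))).differentiableAt (by simp))
    (fun z _ => hg.contDiffAt.differentiableAt (by simp))⟩

/-! ### Plane waves and the two implications -/

namespace PlaneVF

variable {L : PlaneVF} {lam : ℂ}

theorem isWeakSolution_of_classical (hL : L.IsSmooth) {u : ℝ × ℝ → ℂ}
    (hu : ContDiffOn ℝ ∞ u puncturedPlane)
    (h : ∀ z ∈ puncturedPlane, L.A z * fderiv ℝ u z (1, 0) + L.B z * fderiv ℝ u z (0, 1) = 0) :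
    L.IsWeakSolution u := by
  intro φ
  have hΩ := puncturedPlane.isOpen
  have hφ : ContDiff ℝ ∞ φ := φ.contDiff
  have hsub : ∀ f : ℝ × ℝ → ℂ, tsupport (fun z => f z * φ z) ⊆ puncturedPlane := fun f =>
    (tsupport_mul_subset_right (f := f) (g := φ)).trans φ.tsupport_subset
  obtain ⟨a1, a2, a3⟩ := integrable_and_integral_mul_fderiv hΩ hu
    (contDiff_mul_of_tsupport_subset hΩ hL.1 hφ φ.tsupport_subset)
    φ.hasCompactSupport.mul_left (hsub L.A) (1, 0)
  obtain ⟨b1, b2, b3⟩ := integrable_and_integral_mul_fderiv hΩ hu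
    (contDiff_mul_of_tsupport_subset hΩ hL.2 hφ φ.tsupport_subset)
    φ.hasCompactSupport.mul_left (hsub L.B) (0, 1)
  simp only [transpose, mul_neg, mul_add]
  rw [integral_neg, integral_add a1 b1, a3, b3, ← neg_add, neg_neg, ← integral_add a2 b2]
  refine integral_eq_zero_of_ae (ae_of_all _ fun z => ?_)
  by_cases hz : z ∈ puncturedPlane
  · simp only [Pi.zero_apply]
    linear_combination φ z * h z hz
  · have : φ z = 0 := image_eq_zero_of_notMem_tsupport fun h' => hz (φ.tsupport_subset h')
    simp [this]

/-- The plane wave `exp (i ξ (s + ∫₀^θ c))` in logarithmic polar coordinates. -/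
def wave (L : PlaneVF) (ξ : ℝ) (w : ℝ × ℝ) : ℂ :=
  Complex.exp (Complex.I * ξ * (w.1 + primitive L.slope w.2))

/-- The wave is a function of the first integral `s + C(θ)`; periodicity makes it smooth across the
cut, hence a classical solution. -/
theorem isWeakSolution_wave (hL : L.IsSmooth) (hhom : L.IsHomogeneous lam)
    (hC2 : ∀ z ∈ puncturedPlane, wedge L radial z ≠ 0) {ξ : ℝ}
    (hper : ∀ s, Function.Periodic (fun θ => L.wave ξ (s, θ)) (2 * Real.pi)) :
    ContDiffOn ℝ ∞ (fun z => L.wave ξ (logPolar z)) puncturedPlane ∧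
      L.IsWeakSolution fun z => L.wave ξ (logPolar z) := by
  have hc := contDiff_slope hL hC2
  have hU : ContDiff ℝ ∞ (L.wave ξ) :=
    Complex.contDiff_exp.comp (contDiff_const.mul
      ((Complex.ofRealCLM.contDiff.comp contDiff_fst).add
        ((contDiff_primitive hc).comp contDiff_snd)))
  have hsm : ContDiffOn ℝ ∞ (fun z => L.wave ξ (logPolar z)) puncturedPlane := fun z hz =>
    (contDiffAt_comp_logPolar hper hU hz).contDiffWithinAt
  refine ⟨hsm, isWeakSolution_of_classical hL hsm fun z hz => ?_⟩
  obtain ⟨w, rfl⟩ : ∃ w, expPolar w = z := ⟨logPolar z, expPolar_logPolar hz⟩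
  have hd := (contDiffAt_comp_logPolar hper hU hz).differentiableAt (by simp)
  have h1 := hasDerivAt_comp_expPolar_fst (s := w.1) (θ := w.2) hd
  have h2 := hasDerivAt_comp_expPolar_snd (s := w.1) (θ := w.2) hd
  simp_rw [comp_logPolar_expPolar hper] at h1 h2
  have h3 := h1.unique (((hasDerivAt_id w.1).ofReal_comp.add_const
    (primitive L.slope w.2)).const_mul (Complex.I * ξ)).cexp
  have h4 := h2.unique (((hasDerivAt_primitive hc.continuous w.2).const_add
    (w.1 : ℂ)).const_mul (Complex.I * ξ)).cexp
  have hr := radial_coeff_expPolar hhom hC2 w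
  have hr2 : ((expPolar w).1 : ℂ) ^ 2 + ((expPolar w).2 : ℂ) ^ 2 ≠ 0 := by
    intro h0
    have h0' : (expPolar w).1 ^ 2 + (expPolar w).2 ^ 2 = 0 := by exact_mod_cast h0
    apply expPolar_ne_zero w
    ext
    · simp only [Prod.fst_zero]
      nlinarith [sq_nonneg (expPolar w).1, sq_nonneg (expPolar w).2]
    · simp only [Prod.snd_zero]
      nlinarith [sq_nonneg (expPolar w).1, sq_nonneg (expPolar w).2]
  have hD : L.angular (expPolar w) = L.B (expPolar w) * (expPolar w).1 -
    L.A (expPolar w) * (expPolar w).2 := rfl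
  simp only [Prod.mk.eta, Complex.ofReal_one, mul_one, id] at h3 h4
  generalize fderiv ℝ (fun z => L.wave ξ (logPolar z)) (expPolar w) (1, 0) = X at *
  generalize fderiv ℝ (fun z => L.wave ξ (logPolar z)) (expPolar w) (0, 1) = Y at *
  generalize Complex.exp _ = E at *
  -- Multiplying by `x² + y²` splits `L` into its radial coefficient times `∂s` plus `angular` times
  -- `∂θ`.
  refine (mul_eq_zero.1 (?_ : (((expPolar w).1 : ℂ) ^ 2 + ((expPolar w).2 : ℂ) ^ 2) *
    (L.A (expPolar w) * X + L.B (expPolar w) * Y) = 0)).resolve_left hr2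
  linear_combination ((expPolar w).1 * X + (expPolar w).2 * Y) * hr -
    (-(expPolar w).2 * X + (expPolar w).1 * Y) * hD +
    L.angular (expPolar w) * (h4 - L.slope w.2 * h3)

theorem not_liouvilleProperty (hL : L.IsSmooth) (hhom : L.IsHomogeneous lam)
    (hC2 : ∀ z ∈ puncturedPlane, wedge L radial z ≠ 0) (hmu : L.mu.re = 0) :
    ¬ L.LiouvilleProperty := by
  have hc := contDiff_slope hL hC2
  have hCc := (contDiff_primitive hc).continuous
  obtain ⟨τ, hτ⟩ : ∃ τ : ℝ, ∫ θ in (0 : ℝ)..(2 * Real.pi), L.slope θ = τ := by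
    refine ⟨-(2 * Real.pi * L.mu.im), ?_⟩
    rw [integral_slope]
    apply Complex.ext <;> simp [hmu]
  obtain ⟨ξ, hξ, k, hk⟩ : ∃ ξ : ℝ, ξ ≠ 0 ∧ ∃ k : ℤ, ξ * τ = k * (2 * Real.pi) := by
    by_cases h : τ = 0
    · exact ⟨1, one_ne_zero, 0, by simp [h]⟩
    · refine ⟨2 * Real.pi / τ, div_ne_zero (by positivity) h, 1, ?_⟩
      field_simp
      simp
  have hper : ∀ s, Function.Periodic (fun θ => L.wave ξ (s, θ)) (2 * Real.pi) := by
    intro s θ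
    have h := primitive_sub_of_periodic hc.continuous L.slope_periodic θ
    rw [hτ, sub_eq_iff_eq_add] at h
    have hk' : (ξ : ℂ) * τ = k * (2 * Real.pi) := by exact_mod_cast hk
    simp only [wave]
    rw [Complex.exp_eq_exp_iff_exists_int]
    refine ⟨k, ?_⟩
    rw [h]
    linear_combination Complex.I * hk'
  obtain ⟨hsm, hweak⟩ := isWeakSolution_wave hL hhom hC2 hper
  intro hLiou
  obtain ⟨m, hm⟩ := hLiou _ hsm.continuousOn (by
    have hcont : ContinuousOn (fun θ => L.wave ξ (0, θ)) (Icc (-Real.pi) Real.pi) := by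
      unfold wave
      fun_prop
    obtain ⟨C, hC⟩ := isCompact_Icc.exists_bound_of_continuousOn hcont
    refine ⟨C, fun z _ => ?_⟩
    -- As `ξ` is real, the modulus is independent of `s`, so a bound on a compact range of angles
    -- suffices.
    have e : ‖L.wave ξ (logPolar z)‖ = ‖L.wave ξ (0, (logPolar z).2)‖ := by
      simp [wave, Complex.norm_exp]
    rw [e]
    refine hC _ ?_
    rw [logPolar_snd]
    exact ⟨(Complex.neg_pi_lt_arg _).le, Complex.arg_le_pi _⟩) hweak
  have h1 := hm _ (expPolar_ne_zero (0, 0))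
  -- Moving `s` by `π / ξ` flips the sign of the wave.
  have h2 := hm _ (expPolar_ne_zero (Real.pi / ξ, 0))
  simp only [comp_logPolar_expPolar hper] at h1 h2
  have h3 : L.wave ξ (0, 0) = 1 := by simp [wave, primitive]
  have h4 : L.wave ξ (Real.pi / ξ, 0) = -1 := by
    have hξ' : (ξ : ℂ) ≠ 0 := by exact_mod_cast hξ
    rw [← Complex.exp_pi_mul_I, wave]
    congr 1
    simp only [primitive, intervalIntegral.integral_same, add_zero]
    push_cast
    field_simp
  rw [h3] at h1
  rw [h4, ← h1] at h2
  norm_num at h2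

theorem liouvilleProperty_of_mu_re_ne_zero (hL : L.IsSmooth) (hhom : L.IsHomogeneous lam)
    (hC2 : ∀ z ∈ puncturedPlane, wedge L radial z ≠ 0) (hmu : L.mu.re ≠ 0) :
    L.LiouvilleProperty := by
  rintro u hu ⟨M, hM⟩ hweak
  have hc := contDiff_slope hL hC2
  have hT : IsWeakTransport L.slope fun w => u (expPolar w) := fun F hF hFc hFt =>
    hweak.integral_strip hL hhom hC2 hF hFc hFt
  have h := primitive_sub_of_periodic hc.continuous L.slope_periodic (-Real.pi)
  rw [show -Real.pi + 2 * Real.pi = Real.pi by ring, integral_slope] at h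
  obtain ⟨k, hk⟩ := hT.eq_const hc
    (hu.comp_continuous continuous_expPolar fun w => expPolar_ne_zero w)
    (fun w => hM _ (expPolar_ne_zero w)) (fun s => by simp [expPolar]) (by
      rw [h]
      simpa using hmu)
  refine ⟨k, fun z hz => ?_⟩
  have := hk (logPolar z).1 (logPolar z).2 (by
    rw [logPolar_snd]
    exact ⟨(Complex.neg_pi_lt_arg _).le, Complex.arg_le_pi _⟩)
  rwa [Prod.mk.eta, expPolar_logPolar hz] at this

end PlaneVF

end

theorem theorem3p6 (L : PlaneVF) (lam : ℂ) (hlam : 1 < lam.re)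
    (hsmooth : L.IsSmooth) (hhom : L.IsHomogeneous lam)
    (hC1 : interior L.charSet = ∅)
    (hC2 : ∀ z ∈ puncturedPlane, PlaneVF.wedge L PlaneVF.radial z ≠ 0) :
    L.LiouvilleProperty ↔ L.mu.re ≠ 0 :=
  ⟨fun h hmu => PlaneVF.not_liouvilleProperty hsmooth hhom hC2 hmu h,
    PlaneVF.liouvilleProperty_of_mu_re_ne_zero hsmooth hhom hC2⟩
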